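/- Let $V$ be a finite vertex set, let $w$ assign a positive weight to every unordered pair of distinct vertices, and let $(V,E_{\mathrm{init}})$ be a connected simple graph. For an edge set $E$ let $t_w(E)=\sum_T\prod_{e\in T}w(e)$, the sum being over the edge sets $T$ of the spanning trees of $(V,E)$, let $\tau_w(E)=\log t_w(E)$ if $t_w(E)>0$ and $\tau_w(E)=0$ otherwise, and let $\varphi(E)=\tau_w(E\cup E_{\mathrm{init}})-\tau_w(E_{\mathrm{init}})$ be the tree-connectivity gain. Let $\mathcal M^+$ be a set of pairs of distinct vertices that is disjoint from $E_{\mathrm{init}}$, let $0\le\delta\le\varphi(\mathcal M^+)$, and put $$k_{\mathsf{OPT}}=\min\{|E| : E\subseteq\mathcal M^+,\ \varphi(E)\ge\delta\}.$$ Fix any anchor vertex $v_0$. For $e=\{u,v\}$ let $a_e=\mathbf e_u-\mathbf e_v$ with the coordinate of $v_0$ deleted (the sign of $a_e$ is irrelevant), and let $L_e=w(e)\,a_ea_e^\top$. For $\pi\in\mathbb R^{\mathcal M^+}$ let $\mathbf L(\pi)=\sum_{e\in E_{\mathrm{init}}}L_e+\sum_{e\in\mathcal M^+}\pi_eL_e$,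 and let $\tau_{\mathrm{init}}=\log\det\mathbf L(\mathbf 0)$. Say that $E\subseteq \mathcal M^+$ reaches the bound if $\log\det\mathbf L(\mathbf 1_E)\ge\delta+\tau_{\mathrm{init}}$. * Greedy algorithm: start with $E=\varnothing$; as long as $E$ does not reach the bound and $E\ne\mathcal M^+$, add to $E$ an edge $e\in\mathcal M^+\setminus E$ that maximizes $w(e)\,a_e^\top\mathbf L(\mathbf 1_E)^{-1}a_e$, with ties broken arbitrarily. Let $k_{\mathrm{greedy}}$ be the number of edges selected, let $\tilde E_{\mathrm{greedy}}$ be the set $E$ one step before termination, and let $$\gamma=1+\log\frac{\delta}{\delta-\varphi(\tilde E_{\mathrm{greedy}})},$$ with $\gamma=1$ by convention if the algorithm selects no edge. * Convex relaxation: let $\pi^\star$ be any minimizer of $\sum_{e\in\mathcal M^+}\pi_e$ subject to $\log\det\mathbf L(\pi)\ge\delta+\tau_{\mathrm{init}}$ and $0\le\pi_e\le1$ for all $e\in\mathcal M^+$. Sort $\mathcal M^+$ in descending order of $\pi^\star$ (ties in any order) and take edges from the front of the list until the set of edges taken reaches the bound; let $k_{\mathrm{cvx}}$ be the number of edges taken.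 Then, for every run of the greedy algorithm, every minimizer $\pi^\star$ and every such sorting, $$\max\Big\{\tfrac1\gamma\,k_{\mathrm{greedy}},\ \Big\lceil\sum_{e\in\mathcal M^+}\pi^\star_e\Big\rceil\Big\}\ \le\ k_{\mathsf{OPT}}\ \le\ \min\{k_{\mathrm{greedy}},\,k_{\mathrm{cvx}}\}.$$ -/

import Mathlib

namespace TreeDual

variable {V : Type*} [DecidableEq V]

/-! Edge sets on the vertex set `V` are loop-free finite sets of unordered pairs. -/

open Classical in
/-- The spanning trees of `(V, E)`, each one given by its edge set `F ⊆ E`. -/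
noncomputable def spanningTrees (E : Finset (Sym2 V)) : Finset (Finset (Sym2 V)) :=
  E.powerset.filter fun F => (SimpleGraph.fromEdgeSet (F : Set (Sym2 V))).IsTree

/-- The weighted number of spanning trees of `(V, E, w)`: every spanning tree is counted with the
product of the weights of its edges. -/
noncomputable def treeCount (w : Sym2 V → ℝ) (E : Finset (Sym2 V)) : ℝ :=
  ∑ F ∈ spanningTrees E, ∏ e ∈ F, w e

open Classical in
/-- The weighted tree-connectivity of `(V, E, w)`. -/
noncomputable def treeConn (w : Sym2 V → ℝ) (E : Finset (Sym2 V)) : ℝ :=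
  if 0 < treeCount w E then Real.log (treeCount w E) else 0

/-- The tree-connectivity gain of adding the edges `E` to the base graph `(V, Einit, w)`. -/
noncomputable def gain (w : Sym2 V → ℝ) (Einit E : Finset (Sym2 V)) : ℝ :=
  treeConn w (E ∪ Einit) - treeConn w Einit

/-- The optimum value of the dual edge selection problem: the least number of edges of the
candidate set `M` whose tree-connectivity gain is at least `δ`. -/
noncomputable def kOPT (w : Sym2 V → ℝ) (Einit M : Finset (Sym2 V)) (δ : ℝ) : ℕ :=
  sInf {k : ℕ | ∃ E : Finset (Sym2 V), E ⊆ M ∧ δ ≤ gain w Einit E ∧ E.card = k}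

/-! ### Reduced Laplacians, with the row and column of the anchor `v₀` removed -/

/-- The column `e_u - e_v` of the reduced incidence matrix, for the orientation `(u, v)`. -/
def incVec (v₀ u v : V) : {x : V // x ≠ v₀} → ℝ :=
  fun x => (if (x : V) = u then 1 else 0) - (if (x : V) = v then 1 else 0)

theorem incVec_swap (v₀ u v : V) : incVec v₀ v u = -incVec v₀ u v := by
  funext x
  simp [incVec]

/-- The (unweighted) elementary reduced Laplacian `a_{uv} a_{uv}ᵀ` of the edge `{u, v}`; it does
not depend on the orientation. -/
def elemLap (v₀ : V) (e : Sym2 V) : Matrix {x : V // x ≠ v₀} {x : V // x ≠ v₀} ℝ :=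
  Sym2.lift ⟨fun u v => Matrix.vecMulVec (incVec v₀ u v) (incVec v₀ u v), fun u v => by
    dsimp only
    rw [incVec_swap v₀ u v, Matrix.neg_vecMulVec, Matrix.vecMulVec_neg, neg_neg]⟩ e

/-- The reduced weighted Laplacian of `(V, E, w)`. -/
noncomputable def redLap (v₀ : V) (w : Sym2 V → ℝ) (E : Finset (Sym2 V)) :
    Matrix {x : V // x ≠ v₀} {x : V // x ≠ v₀} ℝ :=
  ∑ e ∈ E, w e • elemLap v₀ e

/-- `L(π) = ∑_{e ∈ Einit} L_e + ∑_{e ∈ M} π_e L_e`, where `L_e = w(e) a_e a_eᵀ`. -/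
noncomputable def lapPi (v₀ : V) (w : Sym2 V → ℝ) (Einit M : Finset (Sym2 V)) (π : Sym2 V → ℝ) :
    Matrix {x : V // x ≠ v₀} {x : V // x ≠ v₀} ℝ :=
  ∑ e ∈ Einit, w e • elemLap v₀ e + ∑ e ∈ M, π e • (w e • elemLap v₀ e)

variable [Fintype V]

/-- `Δ_e = a_eᵀ L⁻¹ a_e`; it does not depend on the orientation of `e`. -/
noncomputable def effRes (v₀ : V) (L : Matrix {x : V // x ≠ v₀} {x : V // x ≠ v₀} ℝ)
    (e : Sym2 V) : ℝ :=
  Sym2.lift ⟨fun u v => incVec v₀ u v ⬝ᵥ (L⁻¹.mulVec (incVec v₀ u v)), fun u v => by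
    dsimp only
    rw [incVec_swap v₀ u v, Matrix.mulVec_neg, neg_dotProduct_neg]⟩ e

/-- `τ_init = log det L(0)`. -/
noncomputable def tauInit (v₀ : V) (w : Sym2 V → ℝ) (Einit M : Finset (Sym2 V)) : ℝ :=
  Real.log (lapPi v₀ w Einit M 0).det

/-! ### The greedy algorithm -/

/-- `e` is a best remaining edge when the edges `E` have already been added: it maximizes
`w(f) Δ_f` over all `f ∈ M \ E`, where `Δ` refers to the graph `(V, Einit ∪ E, w)`. -/
def IsBestEdge (v₀ : V) (w : Sym2 V → ℝ) (Einit M E : Finset (Sym2 V)) (e : Sym2 V) : Prop :=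
  e ∈ M \ E ∧ ∀ f ∈ M \ E,
    w f * effRes v₀ (redLap v₀ w (Einit ∪ E)) f ≤ w e * effRes v₀ (redLap v₀ w (Einit ∪ E)) e

/-- The loop condition of the greedy algorithm: the edges `E` do not yet achieve the gain `δ`, and
some candidates remain. -/
def GreedyContinues (v₀ : V) (w : Sym2 V → ℝ) (Einit M : Finset (Sym2 V)) (δ : ℝ)
    (E : Finset (Sym2 V)) : Prop :=
  Real.log (redLap v₀ w (Einit ∪ E)).det < δ + tauInit v₀ w Einit M ∧ E ≠ M

/-- The lists of edges that the greedy algorithm may have picked after some number of rounds, the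
most recent edge first. Ties between best edges may be broken in any way. -/
inductive GreedyReaches (v₀ : V) (w : Sym2 V → ℝ) (Einit M : Finset (Sym2 V)) (δ : ℝ) :
    List (Sym2 V) → Prop
  | start : GreedyReaches v₀ w Einit M δ []
  | step (l : List (Sym2 V)) (e : Sym2 V) :
      GreedyReaches v₀ w Einit M δ l →
      GreedyContinues v₀ w Einit M δ l.toFinset →
      IsBestEdge v₀ w Einit M l.toFinset e →
      GreedyReaches v₀ w Einit M δ (e :: l)

/-- `l` lists the edges picked by a complete run of the greedy algorithm, the last edge first. -/
def IsGreedyOutput (v₀ : V) (w : Sym2 V → ℝ) (Einit M : Finset (Sym2 V)) (δ : ℝ)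
    (l : List (Sym2 V)) : Prop :=
  GreedyReaches v₀ w Einit M δ l ∧ ¬ GreedyContinues v₀ w Einit M δ l.toFinset

/-- Wolsey's a-posteriori factor `γ = 1 + log (δ / (δ - φ(E')))` of a complete greedy run, where
`E'` is the set of edges one step before termination. If the run picks no edge at all, there is no
such set, and `γ = 1` by convention. -/
noncomputable def wolseyFactor (w : Sym2 V → ℝ) (Einit : Finset (Sym2 V)) (δ : ℝ) :
    List (Sym2 V) → ℝ
  | [] => 1
  | _ :: l => 1 + Real.log (δ / (δ - gain w Einit l.toFinset))

/-! ### The convex relaxation and its rounding -/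

/-- The feasible set of the relaxed dual problem. -/
def RelaxFeasible (v₀ : V) (w : Sym2 V → ℝ) (Einit M : Finset (Sym2 V)) (δ : ℝ)
    (π : Sym2 V → ℝ) : Prop :=
  δ + tauInit v₀ w Einit M ≤ Real.log (lapPi v₀ w Einit M π).det ∧
    ∀ e ∈ M, 0 ≤ π e ∧ π e ≤ 1

/-- `π` minimizes `∑_{e ∈ M} π_e` over the feasible set of the relaxed dual problem. -/
def IsRelaxMinimizer (v₀ : V) (w : Sym2 V → ℝ) (Einit M : Finset (Sym2 V)) (δ : ℝ)
    (π : Sym2 V → ℝ) : Prop :=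
  RelaxFeasible v₀ w Einit M δ π ∧
    ∀ ρ : Sym2 V → ℝ, RelaxFeasible v₀ w Einit M δ ρ → ∑ e ∈ M, π e ≤ ∑ e ∈ M, ρ e

/-- The selection of the edges `E` (as a 0-1 vector) achieves the gain `δ`. -/
def SelectionFeasible (v₀ : V) (w : Sym2 V → ℝ) (Einit M : Finset (Sym2 V)) (δ : ℝ)
    (E : Finset (Sym2 V)) : Prop :=
  δ + tauInit v₀ w Einit M ≤
    Real.log (lapPi v₀ w Einit M (fun e => if e ∈ E then 1 else 0)).det

/-- The deterministic rounding of `π` selects `k` edges: for some list of all the candidates in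
descending order of `π` (ties in any order), edges are taken from the front of the list until the
selection achieves the gain `δ`, which happens first after `k` edges. -/
def IsRoundingCount (v₀ : V) (w : Sym2 V → ℝ) (Einit M : Finset (Sym2 V)) (δ : ℝ)
    (π : Sym2 V → ℝ) (k : ℕ) : Prop :=
  ∃ l : List (Sym2 V), l.Nodup ∧ l.toFinset = M ∧ l.Pairwise (fun e f => π f ≤ π e) ∧
    k ≤ l.length ∧
    SelectionFeasible v₀ w Einit M δ (l.take k).toFinset ∧
    ∀ j < k, ¬ SelectionFeasible v₀ w Einit M δ (l.take j).toFinset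

end TreeDual

/-! ### Cauchy–Binet for weighted Gram matrices. -/

section CauchyBinet

open Matrix Finset

variable {ι n R : Type*} [Fintype n] [DecidableEq n] [CommRing R]

/-! By the matrix-tree theorem (`det_redLap`: Cauchy–Binet, plus the fact that a square submatrix of
the reduced incidence matrix has determinant ±1 for a spanning tree and 0 otherwise), the gain of
`E` is a difference of log-determinants of reduced Laplacians (`gain_eq`). So the combinatorial
problem, the greedy stopping test and the 0-1 points of the relaxation all express the same
constraint (`le_gain_iff`, `lapPi_indicator`).

Three of the four bounds then follow directly: the greedy and rounded selections are feasible, hence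
no smaller than the optimum, and the indicator of an optimal set is feasible for the relaxation.

The greedy lower bound is Wolsey's argument. Adding an edge raises the log-determinant by `log (1 +
w e * Δ_e)`, and `Δ_e` decreases as edges are added, so the gain is monotone and submodular. Hence
each greedy edge closes at least a fraction `1/k` of the missing gain, where `k` is the optimum. The
missing gain decays like `(1 - 1/k)^i * δ`, which bounds the number of rounds before the last edge
by `k * log (δ / missing gain)`. -/

/-- Row `i` of the sum is a combination of the `b e` with coefficients `c e * b e i`; the
determinant is multilinear in its rows. -/
theorem Matrix.det_sum_vecMulVec_eq_sum_piFinset (b : ι → n → R) (c : ι → R) (s : Finset ι) :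
    (∑ e ∈ s, c e • vecMulVec (b e) (b e)).det =
      ∑ f ∈ Fintype.piFinset fun _ : n => s,
        (∏ i, c (f i)) * ((∏ i, b (f i) i) * (of fun i => b (f i)).det) := by
  have h : (∑ e ∈ s, c e • vecMulVec (b e) (b e)) =
      fun i => ∑ e ∈ s, (c e * b e i) • b e := by
    ext i j
    simp [Matrix.sum_apply, vecMulVec_apply, mul_assoc]
  rw [h]
  have h2 := (detRowAlternating : (n → R) [⋀^n]→ₗ[R] R).toMultilinearMap.map_sum_finset
    (fun i e => (c e * b e i) • b e) (fun _ => s)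
  refine h2.trans (sum_congr rfl fun f _ => ?_)
  refine ((detRowAlternating : (n → R) [⋀^n]→ₗ[R] R).toMultilinearMap.map_smul_univ
    (fun i => c (f i) * b (f i) i) (fun i => b (f i))).trans ?_
  rw [prod_mul_distrib, smul_eq_mul, mul_assoc]
  rfl

theorem Matrix.det_sum_vecMulVec_eq_sum_injective [DecidableEq ι] (b : ι → n → R) (c : ι → R)
    (s : Finset ι) :
    (∑ e ∈ s, c e • vecMulVec (b e) (b e)).det =
      ∑ f ∈ (Fintype.piFinset fun _ : n => s) with Function.Injective f,
        (∏ i, c (f i)) * ((∏ i, b (f i) i) * (of fun i => b (f i)).det) := by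
  classical
  rw [det_sum_vecMulVec_eq_sum_piFinset, sum_filter_of_ne]
  intro f _ hne
  by_contra hinj
  simp only [Function.Injective, not_forall] at hinj
  obtain ⟨i, j, hij, hne'⟩ := hinj
  apply hne
  rw [det_zero_of_row_eq hne', mul_zero, mul_zero]
  funext x
  simp [hij]

/-- The Cauchy–Binet formula for weighted Gram matrices. -/
theorem Matrix.det_sum_vecMulVec [DecidableEq ι] (b : ι → n → R) (c : ι → R) (s : Finset ι) :
    (∑ e ∈ s, c e • vecMulVec (b e) (b e)).det =
      ∑ F ∈ s.powersetCard (Fintype.card n),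
        (∏ e ∈ F, c e) * (∑ e ∈ F, vecMulVec (b e) (b e)).det := by
  classical
  -- Injective choices are grouped by their image `F`; each group is the same expansion for `F`
  -- alone with unit weights.
  rw [det_sum_vecMulVec_eq_sum_injective, ← sum_fiberwise_of_maps_to
    (t := s.powersetCard (Fintype.card n)) (g := fun f => univ.image f)]
  · refine sum_congr rfl fun F hF => ?_
    rw [mem_powersetCard] at hF
    have h1 := det_sum_vecMulVec_eq_sum_injective b (fun _ => (1 : R)) F
    simp only [one_smul, prod_const_one, one_mul] at h1
    rw [h1, mul_sum]
    refine sum_congr ?_ fun f hf => ?_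
    · ext f
      simp only [mem_filter, Fintype.mem_piFinset]
      constructor
      · rintro ⟨⟨h1, h2⟩, rfl⟩
        exact ⟨fun i => mem_image_of_mem _ (mem_univ i), h2⟩
      · rintro ⟨h1, h2⟩
        refine ⟨⟨fun i => hF.1 (h1 i), h2⟩, eq_of_subset_of_card_le ?_ ?_⟩
        · exact image_subset_iff.2 fun i _ => h1 i
        · rw [card_image_of_injective _ h2, hF.2, card_univ]
    · simp only [mem_filter, Fintype.mem_piFinset] at hf
      congr 1
      have : F = univ.image f := by
        refine (eq_of_subset_of_card_le ?_ ?_).symm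
        · exact image_subset_iff.2 fun i _ => hf.1 i
        · rw [card_image_of_injective _ hf.2, hF.2, card_univ]
      rw [this, prod_image fun x _ y _ h => hf.2 h]
  · intro f hf
    simp only [mem_filter, Fintype.mem_piFinset] at hf
    rw [mem_powersetCard, card_image_of_injective _ hf.2, card_univ]
    exact ⟨image_subset_iff.2 fun i _ => hf.1 i, rfl⟩

/-- The Gram sum is `BᵀB` with `B` square, so the ordering of `F` does not matter. -/
theorem Matrix.det_sum_vecMulVec_of_equiv (b : ι → n → R) (F : Finset ι) (σ : n ≃ F) :
    (∑ e ∈ F, vecMulVec (b e) (b e)).det = (of fun i => b (σ i)).det ^ 2 := by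
  have : (∑ e ∈ F, vecMulVec (b e) (b e)) = (of fun i => b (σ i))ᵀ * of fun i => b (σ i) := by
    ext i j
    rw [Matrix.sum_apply, mul_apply, ← sum_coe_sort F, ← σ.sum_comp]
    simp [vecMulVec_apply]
  rw [this, det_mul, det_transpose, sq]

end CauchyBinet

/-! ### The weighted matrix-tree theorem. -/

namespace TreeDual

open Matrix Finset SimpleGraph

variable {V : Type*} [DecidableEq V]

/-- The incidence vector of an edge, for an arbitrarily chosen orientation. -/
noncomputable def edgeVec (v₀ : V) (e : Sym2 V) : {x : V // x ≠ v₀} → ℝ :=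
  incVec v₀ e.out.1 e.out.2

theorem sym2_mk_out {α : Type*} (e : Sym2 α) : s(e.out.1, e.out.2) = e := Quot.out_eq e

theorem elemLap_eq (v₀ : V) (e : Sym2 V) :
    elemLap v₀ e = vecMulVec (edgeVec v₀ e) (edgeVec v₀ e) := by
  conv_lhs => rw [← sym2_mk_out e]
  rfl

theorem effRes_eq [Fintype V] (v₀ : V) (L : Matrix {x : V // x ≠ v₀} {x : V // x ≠ v₀} ℝ)
    (e : Sym2 V) : effRes v₀ L e = edgeVec v₀ e ⬝ᵥ L⁻¹ *ᵥ edgeVec v₀ e := by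
  conv_lhs => rw [← sym2_mk_out e]
  rfl

theorem redLap_eq (v₀ : V) (w : Sym2 V → ℝ) (E : Finset (Sym2 V)) :
    redLap v₀ w E = ∑ e ∈ E, w e • vecMulVec (edgeVec v₀ e) (edgeVec v₀ e) := by
  simp [redLap, elemLap_eq]

/-- The extension by zero at the anchor of a vector indexed by the other vertices. -/
def extendZero (v₀ : V) (x : {x : V // x ≠ v₀} → ℝ) (u : V) : ℝ :=
  if h : u ≠ v₀ then x ⟨u, h⟩ else 0

theorem incVec_dotProduct [Fintype V] (v₀ u v : V) (x : {x : V // x ≠ v₀} → ℝ) :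
    incVec v₀ u v ⬝ᵥ x = extendZero v₀ x u - extendZero v₀ x v := by
  have h : ∀ u : V, ∑ i : {x : V // x ≠ v₀}, (if (i : V) = u then (1 : ℝ) else 0) * x i =
      extendZero v₀ x u := by
    intro u
    by_cases hu : u = v₀
    · rw [extendZero, dif_neg (by simpa using hu)]
      refine sum_eq_zero fun i _ => ?_
      rw [if_neg (fun h => i.2 (h.trans hu)), zero_mul]
    · rw [extendZero, dif_pos hu, sum_eq_single ⟨u, hu⟩]
      · simp
      · intro i _ hi
        rw [if_neg (fun h => hi (Subtype.ext h)), zero_mul]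
      · simp
  simp only [dotProduct, incVec, sub_mul, sum_sub_distrib, h]

theorem edgeVec_dotProduct_eq_zero [Fintype V] {v₀ u v : V} {x : {x : V // x ≠ v₀} → ℝ} :
    edgeVec v₀ s(u, v) ⬝ᵥ x = 0 ↔ extendZero v₀ x u = extendZero v₀ x v := by
  rw [edgeVec, incVec_dotProduct, sub_eq_zero]
  have h := sym2_mk_out s(u, v)
  rw [Sym2.eq_iff] at h
  rcases h with ⟨h1, h2⟩ | ⟨h1, h2⟩ <;> rw [h1, h2]
  exact eq_comm

/-- A potential that is constant along edges is constant along walks to the anchor, where it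
vanishes. -/
theorem eq_zero_of_forall_edgeVec_dotProduct [Fintype V] (v₀ : V) {F : Finset (Sym2 V)}
    (hF : (fromEdgeSet (F : Set (Sym2 V))).Connected) {x : {x : V // x ≠ v₀} → ℝ}
    (hx : ∀ e ∈ F, edgeVec v₀ e ⬝ᵥ x = 0) : x = 0 := by
  have key : ∀ u, extendZero v₀ x u = 0 := by
    intro u
    obtain ⟨p⟩ := hF.preconnected u v₀
    induction p with
    | nil => simp [extendZero]
    | cons h p ih =>
      rw [fromEdgeSet_adj] at h
      rw [← ih hx, edgeVec_dotProduct_eq_zero.1 (hx _ (by simpa using h.1))]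
  funext i
  have := key i
  rwa [extendZero, dif_pos i.2] at this

theorem exists_edgeVec_dotProduct_eq_zero [Fintype V] (v₀ : V) {F : Finset (Sym2 V)}
    (hF : ¬ (fromEdgeSet (F : Set (Sym2 V))).Connected) :
    ∃ x : {x : V // x ≠ v₀} → ℝ, x ≠ 0 ∧ ∀ e ∈ F, edgeVec v₀ e ⬝ᵥ x = 0 := by
  classical
  set G := fromEdgeSet (F : Set (Sym2 V)) with hG
  obtain ⟨v, hv⟩ : ∃ v, ¬ G.Reachable v₀ v := by
    by_contra! h
    exact hF ((connected_iff_exists_forall_reachable G).2 ⟨v₀, h⟩)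
  -- The indicator of the vertices outside the anchor's component.
  let x : {x : V // x ≠ v₀} → ℝ := fun i => if G.Reachable v₀ i then 0 else 1
  have hext : ∀ u, extendZero v₀ x u = if G.Reachable v₀ u then 0 else 1 := by
    intro u
    by_cases hu : u = v₀
    · subst hu
      simp [extendZero]
    · rw [extendZero, dif_pos hu]
  have hv₀ : v ≠ v₀ := by
    rintro rfl
    exact hv (Reachable.refl _)
  refine ⟨x, fun h => ?_, fun e he => ?_⟩
  · have := congr_fun h ⟨v, hv₀⟩
    simp [x, hv] at this
  · induction e with | _ a b
    rw [edgeVec_dotProduct_eq_zero]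
    by_cases hab : a = b
    · rw [hab]
    · have hadj : G.Adj a b := by
        rw [hG, fromEdgeSet_adj]
        exact ⟨by simpa using he, hab⟩
      have : G.Reachable v₀ a ↔ G.Reachable v₀ b :=
        ⟨fun h => h.trans hadj.reachable, fun h => h.trans hadj.symm.reachable⟩
      rw [hext, hext]
      simp only [this]

/-- Telescoping along a walk from `u` to the anchor, whose own basis vector is zero. The span is
over `ℤ` so that an integral inverse results. -/
theorem mem_span_edgeVec (v₀ : V) {F : Finset (Sym2 V)}
    (hF : (fromEdgeSet (F : Set (Sym2 V))).Connected) (u : V) :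
    (fun i : {x : V // x ≠ v₀} => if (i : V) = u then (1 : ℝ) else 0) ∈
      Submodule.span ℤ (edgeVec v₀ '' (F : Set (Sym2 V))) := by
  obtain ⟨p⟩ := hF.preconnected u v₀
  induction p with
  | @nil u =>
    convert Submodule.zero_mem _ using 1
    funext i
    exact if_neg i.2
  | @cons u v z h p ih =>
    rw [fromEdgeSet_adj] at h
    have hmem : edgeVec z s(u, v) ∈ Submodule.span ℤ (edgeVec z '' (F : Set (Sym2 V))) :=
      Submodule.subset_span ⟨_, h.1, rfl⟩
    have hout := sym2_mk_out s(u, v)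
    rw [Sym2.eq_iff] at hout
    rcases hout with ⟨h1, h2⟩ | ⟨h1, h2⟩
    · convert Submodule.add_mem _ ih hmem using 1
      funext i
      simp [edgeVec, incVec, h1, h2]
    · convert Submodule.sub_mem _ ih hmem using 1
      funext i
      simp [edgeVec, incVec, h1, h2]

variable [Fintype V]

/-- The matrix is integral with an integral left inverse, so its determinant is a unit of `ℤ`. -/
theorem det_edgeVec_sq_of_connected (v₀ : V) {F : Finset (Sym2 V)}
    (hF : (fromEdgeSet (F : Set (Sym2 V))).Connected) (σ : {x : V // x ≠ v₀} ≃ F) :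
    (of fun i => edgeVec v₀ (σ i)).det ^ 2 = 1 := by
  have hrange : edgeVec v₀ '' (F : Set (Sym2 V)) = Set.range fun i : {x : V // x ≠ v₀} => edgeVec v₀ (σ i) := by
    ext y
    constructor
    · rintro ⟨e, he, rfl⟩
      exact ⟨σ.symm ⟨e, he⟩, by simp⟩
    · rintro ⟨i, rfl⟩
      exact ⟨_, (σ i).2, rfl⟩
  have hspan : ∀ j : {x : V // x ≠ v₀},
      ∃ c : {x : V // x ≠ v₀} → ℤ, ∑ i, c i • edgeVec v₀ (σ i) =
      fun i : {x : V // x ≠ v₀} => if (i : V) = j then (1 : ℝ) else 0 := fun j => by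
    rw [← Submodule.mem_span_range_iff_exists_fun ℤ, ← hrange]
    exact mem_span_edgeVec v₀ hF j
  choose C hC using hspan
  let B : Matrix {x : V // x ≠ v₀} {x : V // x ≠ v₀} ℤ := of fun i x =>
    (if (x : V) = (σ i : Sym2 V).out.1 then 1 else 0) -
      (if (x : V) = (σ i : Sym2 V).out.2 then 1 else 0)
  have hB : (of fun i => edgeVec v₀ (σ i)) = B.map (Int.castRingHom ℝ) := by
    ext i x
    simp [B, edgeVec, incVec]
  have hCB : (of C).map (Int.castRingHom ℝ) * B.map (Int.castRingHom ℝ) = 1 := by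
    rw [← hB]
    ext j i
    have := congr_fun (hC j) i
    rw [Finset.sum_apply] at this
    simpa [mul_apply, one_apply, Subtype.ext_iff, eq_comm] using this
  have hdet : ((of C).det : ℝ) * (B.det : ℝ) = 1 := by
    have h := congr_arg det hCB
    rw [det_mul, det_one] at h
    have hm : ∀ A : Matrix {x : V // x ≠ v₀} {x : V // x ≠ v₀} ℤ, (A.map (Int.castRingHom ℝ)).det = (A.det : ℝ) := fun A =>
      ((Int.castRingHom ℝ).map_det A).symm
    rwa [hm, hm] at h
  have hunit : IsUnit B.det := by
    refine IsUnit.of_mul_eq_one (of C).det ?_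
    rw [mul_comm]
    exact_mod_cast hdet
  have hm : (B.map (Int.castRingHom ℝ)).det = (B.det : ℝ) := ((Int.castRingHom ℝ).map_det B).symm
  rw [hB, hm]
  rcases Int.isUnit_iff.1 hunit with h | h <;> simp [h]

theorem det_edgeVec_of_not_connected (v₀ : V) {F : Finset (Sym2 V)}
    (hF : ¬ (fromEdgeSet (F : Set (Sym2 V))).Connected) (σ : {x : V // x ≠ v₀} ≃ F) :
    (of fun i => edgeVec v₀ (σ i)).det = 0 := by
  obtain ⟨x, hx, hx0⟩ := exists_edgeVec_dotProduct_eq_zero v₀ hF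
  refine exists_mulVec_eq_zero_iff.1 ⟨x, hx, ?_⟩
  funext i
  exact hx0 _ (σ i).2

theorem isTree_fromEdgeSet_iff (v₀ : V) {F : Finset (Sym2 V)} (hF : ∀ e ∈ F, ¬ e.IsDiag) :
    (fromEdgeSet (F : Set (Sym2 V))).IsTree ↔
      (fromEdgeSet (F : Set (Sym2 V))).Connected ∧ F.card = Fintype.card {x : V // x ≠ v₀} := by
  have h1 : (fromEdgeSet (F : Set (Sym2 V))).edgeSet = F := by
    rw [edgeSet_fromEdgeSet]
    ext e
    simpa using hF e
  have h2 : Fintype.card {x : V // x ≠ v₀} + 1 = Nat.card V := by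
    rw [Nat.card_eq_fintype_card, Fintype.card_subtype_compl, Fintype.card_subtype_eq]
    have : 0 < Fintype.card V := Fintype.card_pos_iff.2 ⟨v₀⟩
    omega
  rw [isTree_iff_connected_and_card, h1, Nat.card_coe_set_eq, Set.ncard_coe_finset, ← h2,
    Nat.add_right_cancel_iff]

/-- The weighted matrix-tree theorem. -/
theorem det_redLap (v₀ : V) (w : Sym2 V → ℝ) {E : Finset (Sym2 V)} (hE : ∀ e ∈ E, ¬ e.IsDiag) :
    (redLap v₀ w E).det = treeCount w E := by
  classical
  rw [redLap_eq, det_sum_vecMulVec, treeCount]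
  have hT : spanningTrees E = (E.powersetCard (Fintype.card {x : V // x ≠ v₀})).filter
      fun F : Finset (Sym2 V) => (fromEdgeSet (F : Set (Sym2 V))).Connected := by
    ext F
    simp only [spanningTrees, mem_filter, mem_powerset, mem_powersetCard]
    constructor
    · rintro ⟨h1, h2⟩
      rw [isTree_fromEdgeSet_iff v₀ fun e he => hE e (h1 he)] at h2
      exact ⟨⟨h1, h2.2⟩, h2.1⟩
    · rintro ⟨⟨h1, h2⟩, h3⟩
      exact ⟨h1, (isTree_fromEdgeSet_iff v₀ fun e he => hE e (h1 he)).2 ⟨h3, h2⟩⟩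
  rw [hT, sum_filter]
  refine sum_congr rfl fun F hF => ?_
  rw [mem_powersetCard] at hF
  have σ : {x : V // x ≠ v₀} ≃ F := Fintype.equivOfCardEq (by rw [Fintype.card_coe, hF.2])
  rw [det_sum_vecMulVec_of_equiv _ F σ]
  split_ifs with hc
  · rw [det_edgeVec_sq_of_connected v₀ hc σ, mul_one]
  · rw [det_edgeVec_of_not_connected v₀ hc σ]
    simp

end TreeDual

/-! ### Monotonicity and submodularity of the log-determinant. -/

namespace TreeDual

open Matrix Finset SimpleGraph

variable {V : Type*} [DecidableEq V]

theorem dotProduct_redLap_mulVec [Fintype V] (v₀ : V) (w : Sym2 V → ℝ) (E : Finset (Sym2 V))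
    (x y : {x : V // x ≠ v₀} → ℝ) :
    x ⬝ᵥ redLap v₀ w E *ᵥ y =
      ∑ e ∈ E, w e * ((edgeVec v₀ e ⬝ᵥ x) * (edgeVec v₀ e ⬝ᵥ y)) := by
  rw [redLap_eq, sum_mulVec, dotProduct_sum]
  refine sum_congr rfl fun e _ => ?_
  rw [smul_mulVec, dotProduct_smul, vecMulVec_mulVec, dotProduct_smul, dotProduct_comm x]
  simp only [smul_eq_mul, MulOpposite.smul_eq_mul_unop, MulOpposite.unop_op]

theorem redLap_isHermitian (v₀ : V) (w : Sym2 V → ℝ) (E : Finset (Sym2 V)) :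
    (redLap v₀ w E).IsHermitian := by
  rw [redLap_eq]
  ext i j
  simp [Matrix.sum_apply, vecMulVec_apply, mul_comm]

/-- The edge set of a connected graph on `V`, without loops. -/
structure IsConnectedEdgeSet (E : Finset (Sym2 V)) : Prop where
  not_isDiag : ∀ e ∈ E, ¬ e.IsDiag
  connected : (fromEdgeSet (E : Set (Sym2 V))).Connected

theorem IsConnectedEdgeSet.union {E T : Finset (Sym2 V)} (hE : IsConnectedEdgeSet E)
    (hT : ∀ e ∈ T, ¬ e.IsDiag) : IsConnectedEdgeSet (E ∪ T) where
  not_isDiag e he := (mem_union.1 he).elim (hE.not_isDiag e) (hT e)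
  connected := hE.connected.mono (fromEdgeSet_mono (by simp))

section

variable [Fintype V] {w : Sym2 V → ℝ} (hw : ∀ e : Sym2 V, ¬ e.IsDiag → 0 < w e) (v₀ : V)
include hw

/-- The quadratic form is a positively weighted sum of squared potential differences, and
connectedness makes its kernel trivial. -/
theorem redLap_posDef {E : Finset (Sym2 V)} (hE : IsConnectedEdgeSet E) :
    (redLap v₀ w E).PosDef := by
  refine PosDef.of_dotProduct_mulVec_pos (redLap_isHermitian v₀ w E) fun x hx => ?_
  rw [star_trivial, dotProduct_redLap_mulVec]
  have hnn : ∀ e ∈ E, 0 ≤ w e * ((edgeVec v₀ e ⬝ᵥ x) * (edgeVec v₀ e ⬝ᵥ x)) := fun e he =>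
    mul_nonneg (hw e (hE.not_isDiag e he)).le (mul_self_nonneg _)
  refine lt_of_le_of_ne (sum_nonneg hnn) fun h => hx ?_
  refine eq_zero_of_forall_edgeVec_dotProduct v₀ hE.connected fun e he => ?_
  have := (sum_eq_zero_iff_of_nonneg hnn).1 h.symm e he
  simpa [(hw e (hE.not_isDiag e he)).ne'] using this

theorem det_redLap_pos {E : Finset (Sym2 V)} (hE : IsConnectedEdgeSet E) :
    0 < (redLap v₀ w E).det :=
  (redLap_posDef hw v₀ hE).det_pos

theorem treeConn_eq_log_det {E : Finset (Sym2 V)} (hE : IsConnectedEdgeSet E) :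
    treeConn w E = Real.log (redLap v₀ w E).det := by
  have h := det_redLap_pos hw v₀ hE
  rw [det_redLap v₀ w hE.not_isDiag] at h ⊢
  rw [treeConn, if_pos h]

theorem effRes_nonneg {E : Finset (Sym2 V)} (hE : IsConnectedEdgeSet E) (e : Sym2 V) :
    0 ≤ effRes v₀ (redLap v₀ w E) e := by
  rw [effRes_eq]
  exact (redLap_posDef hw v₀ hE).inv.posSemidef.dotProduct_mulVec_nonneg _

/-- With `L x = a = L' y`, expanding `0 ≤ (x - y)ᵀ L (x - y)` and using `yᵀ L y ≤ yᵀ L' y = yᵀ a`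
leaves `yᵀ a ≤ xᵀ a`. -/
theorem effRes_antitone {E E' : Finset (Sym2 V)} (hE : IsConnectedEdgeSet E)
    (hE' : IsConnectedEdgeSet E') (h : E ⊆ E') (e : Sym2 V) :
    effRes v₀ (redLap v₀ w E') e ≤ effRes v₀ (redLap v₀ w E) e := by
  rw [effRes_eq, effRes_eq]
  set a := edgeVec v₀ e
  set L := redLap v₀ w E with hL
  set L' := redLap v₀ w E' with hL'
  set x := L⁻¹ *ᵥ a with hx
  set y := L'⁻¹ *ᵥ a with hy
  have hLx : L *ᵥ x = a := by
    rw [hx, mulVec_mulVec, mul_nonsing_inv _ (det_redLap_pos hw v₀ hE).ne'.isUnit, one_mulVec]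
  have hLy : L' *ᵥ y = a := by
    rw [hy, mulVec_mulVec, mul_nonsing_inv _ (det_redLap_pos hw v₀ hE').ne'.isUnit, one_mulVec]
  have h1 : 0 ≤ (x - y) ⬝ᵥ L *ᵥ (x - y) :=
    (redLap_posDef hw v₀ hE).posSemidef.dotProduct_mulVec_nonneg (x - y)
  have h2 : x ⬝ᵥ L *ᵥ y = y ⬝ᵥ a := by
    rw [← hLx, hL, dotProduct_redLap_mulVec, dotProduct_redLap_mulVec]
    simp only [mul_comm]
  have h3 : y ⬝ᵥ L *ᵥ y ≤ y ⬝ᵥ a := by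
    rw [← hLy, hL, hL', dotProduct_redLap_mulVec, dotProduct_redLap_mulVec]
    exact sum_le_sum_of_subset_of_nonneg h fun f hf _ =>
      mul_nonneg (hw f (hE'.not_isDiag f hf)).le (mul_self_nonneg _)
  rw [mulVec_sub, hLx, sub_dotProduct, dotProduct_sub, dotProduct_sub, h2] at h1
  rw [dotProduct_comm a, dotProduct_comm a]
  linarith

/-- The matrix determinant lemma for a rank-one update. -/
theorem log_det_redLap_insert {E : Finset (Sym2 V)} (hE : IsConnectedEdgeSet E) {e : Sym2 V}
    (he : e ∉ E) (hd : ¬ e.IsDiag) :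
    Real.log (redLap v₀ w (insert e E)).det = Real.log (redLap v₀ w E).det +
      Real.log (1 + w e * effRes v₀ (redLap v₀ w E) e) := by
  have hpos := det_redLap_pos hw v₀ hE
  have hins : redLap v₀ w (insert e E) = redLap v₀ w E +
      replicateCol Unit (w e • edgeVec v₀ e) * replicateRow Unit (edgeVec v₀ e) := by
    rw [← vecMulVec_eq, smul_vecMulVec, redLap_eq, redLap_eq, sum_insert he, add_comm]
  have hr := mul_nonneg (hw e hd).le (effRes_nonneg hw v₀ hE e)
  rw [← Real.log_mul hpos.ne' (by linarith), hins,
    det_add_replicateCol_mul_replicateRow hpos.ne'.isUnit, det_unique (n := Unit), effRes_eq,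
    Matrix.add_apply, one_apply_eq, Matrix.mul_assoc, ← replicateCol_mulVec, mulVec_smul]
  congr 3
  simp [mul_apply, dotProduct, mul_sum, mul_left_comm]

theorem log_det_redLap_mono {E T : Finset (Sym2 V)} (hE : IsConnectedEdgeSet E)
    (hT : ∀ e ∈ T, ¬ e.IsDiag) :
    Real.log (redLap v₀ w E).det ≤ Real.log (redLap v₀ w (E ∪ T)).det := by
  induction T using Finset.induction_on with
  | empty => simp
  | insert e T he ih =>
    rw [forall_mem_insert] at hT
    refine (ih hT.2).trans ?_
    by_cases h : e ∈ E ∪ T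
    · rw [union_insert, insert_eq_of_mem h]
    · rw [union_insert, log_det_redLap_insert hw v₀ (hE.union hT.2) h hT.1]
      have := mul_nonneg (hw e hT.1).le (effRes_nonneg hw v₀ (hE.union hT.2) e)
      have := Real.log_nonneg (le_add_of_nonneg_right this)
      linarith

/-- Submodularity of the log-determinant of the reduced Laplacian. -/
theorem log_det_redLap_union_le {E T : Finset (Sym2 V)} (hE : IsConnectedEdgeSet E)
    (hT : ∀ e ∈ T, ¬ e.IsDiag) (hET : Disjoint E T) :
    Real.log (redLap v₀ w (E ∪ T)).det ≤ Real.log (redLap v₀ w E).det +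
      ∑ e ∈ T, Real.log (1 + w e * effRes v₀ (redLap v₀ w E) e) := by
  induction T using Finset.induction_on with
  | empty => simp
  | insert e T he ih =>
    rw [forall_mem_insert] at hT
    rw [disjoint_insert_right] at hET
    have h : e ∉ E ∪ T := by simp [he, hET.1]
    rw [union_insert, log_det_redLap_insert hw v₀ (hE.union hT.2) h hT.1, sum_insert he]
    have h0 := mul_nonneg (hw e hT.1).le (effRes_nonneg hw v₀ (hE.union hT.2) e)
    -- The increment of `e` over `E ∪ T` is at most its increment over `E`.
    have h1 := mul_le_mul_of_nonneg_left
      (effRes_antitone hw v₀ hE (hE.union hT.2) subset_union_left e) (hw e hT.1).le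
    have h2 := Real.log_le_log (by linarith) (add_le_add_right h1 1)
    have h3 := ih hT.2 hET.2
    linarith

/-! ### Gains as log-determinants, and Wolsey's analysis of the greedy algorithm. -/

variable {Einit M : Finset (Sym2 V)} (hEinit : IsConnectedEdgeSet Einit)
include hEinit

theorem gain_eq {E : Finset (Sym2 V)} (hE : ∀ e ∈ E, ¬ e.IsDiag) :
    gain w Einit E =
      Real.log (redLap v₀ w (Einit ∪ E)).det - Real.log (redLap v₀ w Einit).det := by
  rw [gain, union_comm, treeConn_eq_log_det hw v₀ hEinit,
    treeConn_eq_log_det hw v₀ (hEinit.union hE)]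

omit hw hEinit in
theorem tauInit_eq : tauInit v₀ w Einit M = Real.log (redLap v₀ w Einit).det := by
  simp [tauInit, lapPi, redLap]

omit hw hEinit [Fintype V] in
theorem lapPi_indicator (hM : Disjoint Einit M) {E : Finset (Sym2 V)} (hE : E ⊆ M) :
    lapPi v₀ w Einit M (fun e => if e ∈ E then 1 else 0) = redLap v₀ w (Einit ∪ E) := by
  rw [lapPi, redLap, sum_union (hM.mono_right hE)]
  simp only [ite_smul, one_smul, zero_smul, sum_ite_mem, inter_eq_right.2 hE]

/-- An edge set achieves the gain `δ` if and only if its indicator vector reaches the bound on the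
log-determinant. -/
theorem le_gain_iff {E : Finset (Sym2 V)} (hE : ∀ e ∈ E, ¬ e.IsDiag) {δ : ℝ} :
    δ ≤ gain w Einit E ↔
      δ + tauInit v₀ w Einit M ≤ Real.log (redLap v₀ w (Einit ∪ E)).det := by
  rw [gain_eq hw v₀ hEinit hE, tauInit_eq, le_sub_iff_add_le]

variable {δ : ℝ} (hM : ∀ e ∈ M, ¬ e.IsDiag ∧ e ∉ Einit)
include hM

omit hw hEinit hM in
theorem GreedyReaches.subset {l : List (Sym2 V)} (hl : GreedyReaches v₀ w Einit M δ l) :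
    l.Nodup ∧ l.toFinset ⊆ M := by
  induction hl with
  | start => simp
  | step l e _ _ hbest ih =>
    have h := mem_sdiff.1 hbest.1
    rw [List.mem_toFinset] at h
    refine ⟨List.nodup_cons.2 ⟨h.2, ih.1⟩, ?_⟩
    rw [List.toFinset_cons, insert_subset_iff]
    exact ⟨h.1, ih.2⟩

/-- A best edge makes up for at least the average share of the missing gain. -/
theorem sub_gain_le_card_mul {O S : Finset (Sym2 V)} (hO : O ⊆ M) (hOδ : δ ≤ gain w Einit O)
    (hS : S ⊆ M) {e : Sym2 V} (he : IsBestEdge v₀ w Einit M S e) :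
    δ - gain w Einit S ≤ O.card * (gain w Einit (insert e S) - gain w Einit S) := by
  have hMd : ∀ T ⊆ M, ∀ f ∈ T, ¬ f.IsDiag := fun T hT f hf => (hM f (hT hf)).1
  obtain ⟨heS, hbest⟩ := he
  rw [mem_sdiff] at heS
  have hES := hEinit.union (hMd S hS)
  have heE : e ∉ Einit ∪ S := by simp [heS.2, (hM e heS.1).2]
  have hins := log_det_redLap_insert hw v₀ hES heE (hM e heS.1).1
  have hr := mul_nonneg (hw e (hM e heS.1).1).le (effRes_nonneg hw v₀ hES e)
  have hr' := Real.log_nonneg (le_add_of_nonneg_right hr)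
  -- Monotonicity bounds the value at `O` by that at `O ∪ S`; submodularity then splits the step
  -- from `S` to `O ∪ S` into single edges of `O \ S`, each dominated by the best edge `e`.
  have hmono := log_det_redLap_mono hw v₀ (hEinit.union (hMd O hO)) (hMd S hS)
  have hdisj : Disjoint (Einit ∪ S) (O \ S) := by
    rw [disjoint_union_left]
    exact ⟨disjoint_right.2 fun f hf => (hM f (hO (mem_sdiff.1 hf).1)).2, disjoint_sdiff⟩
  have hsub := log_det_redLap_union_le hw v₀ hES (hMd _ (sdiff_subset.trans hO)) hdisj
  have hset : Einit ∪ S ∪ O \ S = Einit ∪ O ∪ S := by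
    rw [union_assoc, union_sdiff_self_eq_union, union_comm S, union_assoc]
  rw [hset] at hsub
  have hsum : ∑ f ∈ O \ S, Real.log (1 + w f * effRes v₀ (redLap v₀ w (Einit ∪ S)) f) ≤
      O.card * Real.log (1 + w e * effRes v₀ (redLap v₀ w (Einit ∪ S)) e) := by
    refine (sum_le_card_nsmul _ _ (Real.log (1 + w e * effRes v₀ (redLap v₀ w (Einit ∪ S)) e))
      fun f hf => ?_).trans ?_
    · have hf' := mem_sdiff.1 hf
      have h0 := mul_nonneg (hw f (hM f (hO hf'.1)).1).le (effRes_nonneg hw v₀ hES f)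
      refine Real.log_le_log (by linarith) (add_le_add_right (hbest f ?_) 1)
      exact mem_sdiff.2 ⟨hO hf'.1, hf'.2⟩
    · rw [nsmul_eq_mul]
      exact mul_le_mul_of_nonneg_right (by exact_mod_cast card_le_card sdiff_subset) hr'
  rw [gain_eq hw v₀ hEinit (hMd O hO)] at hOδ
  rw [gain_eq hw v₀ hEinit (hMd S hS), gain_eq hw v₀ hEinit
    (hMd (insert e S) (insert_subset heS.1 hS)), union_insert, hins, sub_sub_sub_cancel_right,
    add_sub_cancel_left]
  linarith

/-- Each round multiplies the missing gain, initially `δ`, by at most `1 - 1/|O|`. -/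
theorem sub_gain_le_pow {O : Finset (Sym2 V)} (hO : O ⊆ M) (hOδ : δ ≤ gain w Einit O)
    (hcard : 0 < O.card) {l : List (Sym2 V)} (hl : GreedyReaches v₀ w Einit M δ l) :
    δ - gain w Einit l.toFinset ≤ (1 - 1 / (O.card : ℝ)) ^ l.length * δ := by
  have hk : (1 : ℝ) ≤ O.card := by exact_mod_cast hcard
  induction hl with
  | start => simp [gain]
  | step l e hl _ hbest ih =>
    have h := sub_gain_le_card_mul hw v₀ hEinit hM hO hOδ (hl.subset v₀).2 hbest
    rw [List.toFinset_cons, List.length_cons, pow_succ', mul_assoc]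
    have hfac : 0 ≤ 1 - 1 / (O.card : ℝ) := by
      rw [sub_nonneg, div_le_one (by linarith)]
      exact hk
    refine le_trans ?_ (mul_le_mul_of_nonneg_left ih hfac)
    have h' := (div_le_iff₀' (by linarith : (0 : ℝ) < O.card)).2 h
    rw [sub_mul, one_mul, one_div, inv_mul_eq_div]
    linarith

/-- Wolsey's bound: the greedy algorithm selects at most `γ` times as many edges as any selection
that achieves the gain `δ`. -/
theorem card_greedy_le {O : Finset (Sym2 V)} (hO : O ⊆ M) (hOδ : δ ≤ gain w Einit O)
    {l : List (Sym2 V)} (hl : GreedyReaches v₀ w Einit M δ l) :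
    1 / wolseyFactor w Einit δ l * (l.toFinset.card : ℝ) ≤ O.card := by
  cases hl with
  | start => simp
  | step l e hl hcont hbest =>
    have hnd := ((GreedyReaches.step l e hl hcont hbest).subset v₀).1
    have hlM := (hl.subset v₀).2
    -- One step before termination the loop condition still held, so the missing gain is positive
    -- and the logarithm in `γ` is meaningful.
    have hg : 0 < δ - gain w Einit l.toFinset := by
      rw [sub_pos, ← not_le, le_gain_iff hw v₀ hEinit (M := M) fun f hf => (hM f (hlM hf)).1,
        not_le]
      exact hcont.1
    have hcard : 0 < O.card := by
      by_contra h0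
      have h := sub_gain_le_card_mul hw v₀ hEinit hM hO hOδ hlM hbest
      rw [Nat.eq_zero_of_not_pos h0, Nat.cast_zero, zero_mul] at h
      linarith
    have hk : (1 : ℝ) ≤ O.card := by exact_mod_cast hcard
    have hdecay := sub_gain_le_pow hw v₀ hEinit hM hO hOδ hcard hl
    set g := δ - gain w Einit l.toFinset with hgdef
    set k : ℝ := (O.card : ℝ)
    have hfac : 0 ≤ 1 - 1 / k := by
      rw [sub_nonneg, div_le_one (by linarith)]
      exact hk
    have hδ : 0 < δ := pos_of_mul_pos_right (hg.trans_le hdecay) (pow_nonneg hfac _)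
    have hexp : (1 - 1 / k) ^ l.length ≤ Real.exp (-(l.length / k)) := by
      have := pow_le_pow_left₀ hfac (Real.one_sub_le_exp_neg (1 / k)) l.length
      rwa [← Real.exp_nat_mul, mul_neg, mul_one_div] at this
    -- From `1 - 1/k ≤ exp (-1/k)`, the decay reads `g ≤ exp (-l.length / k) * δ`.
    have hlog : l.length / k ≤ Real.log (δ / g) := by
      rw [Real.le_log_iff_exp_le (div_pos hδ hg), le_div_iff₀ hg]
      have h := hdecay.trans (mul_le_mul_of_nonneg_right hexp hδ.le)
      calc Real.exp (l.length / k) * g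
          ≤ Real.exp (l.length / k) * (Real.exp (-(l.length / k)) * δ) :=
            mul_le_mul_of_nonneg_left h (Real.exp_pos _).le
        _ = δ := by rw [← mul_assoc, ← Real.exp_add, add_neg_cancel, Real.exp_zero, one_mul]
    have hlog0 : 0 ≤ Real.log (δ / g) := le_trans (by positivity) hlog
    -- The rounds before the last number at most `k * log (δ / g)`; the last edge costs one more,
    -- and `1 ≤ k`, which gives the summand 1 in `γ`.
    rw [List.toFinset_card_of_nodup hnd, List.length_cons]
    change 1 / (1 + Real.log (δ / g)) * ((l.length + 1 : ℕ) : ℝ) ≤ k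
    rw [one_div, inv_mul_le_iff₀ (by linarith)]
    rw [div_le_iff₀ (by linarith)] at hlog
    push_cast
    linarith

end

end TreeDual

theorem mainTheorem8 {V : Type*} [Fintype V] [DecidableEq V] (v₀ : V)
    (w : Sym2 V → ℝ) (hw : ∀ e : Sym2 V, ¬ e.IsDiag → 0 < w e)
    (Einit : Finset (Sym2 V)) (hEinit : ∀ e ∈ Einit, ¬ e.IsDiag)
    (hconn : (SimpleGraph.fromEdgeSet (Einit : Set (Sym2 V))).Connected)
    (M : Finset (Sym2 V)) (hM : ∀ e ∈ M, ¬ e.IsDiag ∧ e ∉ Einit)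
    (δ : ℝ) (hδ : 0 ≤ δ) (hδM : δ ≤ TreeDual.gain w Einit M)
    (greedy : List (Sym2 V)) (hgreedy : TreeDual.IsGreedyOutput v₀ w Einit M δ greedy)
    (π : Sym2 V → ℝ) (hπ : TreeDual.IsRelaxMinimizer v₀ w Einit M δ π)
    (kcvx : ℕ) (hkcvx : TreeDual.IsRoundingCount v₀ w Einit M δ π kcvx) :
    max ((1 / TreeDual.wolseyFactor w Einit δ greedy) * (greedy.toFinset.card : ℝ))
        ((⌈∑ e ∈ M, π e⌉ : ℤ) : ℝ) ≤ (TreeDual.kOPT w Einit M δ : ℝ) ∧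
      TreeDual.kOPT w Einit M δ ≤ min greedy.toFinset.card kcvx := by
  have hE : TreeDual.IsConnectedEdgeSet Einit := ⟨hEinit, hconn⟩
  have hdisj : Disjoint Einit M := Finset.disjoint_right.2 fun e he => (hM e he).2
  have hle {E : Finset (Sym2 V)} (hEM : E ⊆ M) : δ ≤ TreeDual.gain w Einit E ↔
      δ + TreeDual.tauInit v₀ w Einit M ≤ Real.log (TreeDual.redLap v₀ w (Einit ∪ E)).det :=
    TreeDual.le_gain_iff hw v₀ hE fun e he => (hM e (hEM he)).1
  -- `M` itself is feasible, so the infimum is attained and is not the default value 0 of `sInf ∅`.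
  obtain ⟨O, hO, hOδ, hOcard⟩ :
      TreeDual.kOPT w Einit M δ ∈ {k : ℕ | ∃ E : Finset (Sym2 V), E ⊆ M ∧
        δ ≤ TreeDual.gain w Einit E ∧ E.card = k} :=
    Nat.sInf_mem ⟨M.card, M, subset_rfl, hδM, rfl⟩
  have hopt {E : Finset (Sym2 V)} (hEM : E ⊆ M) (hEδ : δ ≤ TreeDual.gain w Einit E) :
      TreeDual.kOPT w Einit M δ ≤ E.card :=
    Nat.sInf_le ⟨E, hEM, hEδ, rfl⟩
  refine ⟨max_le ?_ ?_, le_min ?_ ?_⟩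
  · rw [← hOcard]
    exact TreeDual.card_greedy_le hw v₀ hE hM hO hOδ hgreedy.1
  · have h := hπ.2 (fun e => if e ∈ O then 1 else 0) ⟨?_, fun e _ => ?_⟩
    · rw [Finset.sum_ite_mem, Finset.inter_eq_right.2 hO, Finset.sum_const, nsmul_one, hOcard] at h
      exact_mod_cast Int.ceil_le.2 (by exact_mod_cast h)
    · rw [TreeDual.lapPi_indicator v₀ hdisj hO]
      exact (hle hO).1 hOδ
    · dsimp only
      split_ifs <;> norm_num
  · have hsub := (hgreedy.1.subset v₀).2
    refine hopt hsub ?_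
    -- The loop ends either with all candidates used, where `hδM` applies, or with the bound
    -- reached.
    by_cases h : greedy.toFinset = M
    · rwa [h]
    · rw [hle hsub]
      by_contra hlt
      exact hgreedy.2 ⟨not_le.1 hlt, h⟩
  · obtain ⟨l, hnd, rfl, -, hk, hfeas, -⟩ := hkcvx
    have hsub : (l.take kcvx).toFinset ⊆ l.toFinset := fun e he => by
      rw [List.mem_toFinset] at he ⊢
      exact List.mem_of_mem_take he
    rw [TreeDual.SelectionFeasible, TreeDual.lapPi_indicator v₀ hdisj hsub] at hfeas
    have h := hopt hsub ((hle hsub).2 hfeas)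
    rwa [List.toFinset_card_of_nodup (hnd.sublist (List.take_sublist _ _)), List.length_take,
      min_eq_left hk] at h
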